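/- Let $\Omega\subseteq\mathbb C^m$ be a domain (a nonempty connected open set). **Conventions.** A function $F(z,w)$ on $\Omega\times\Omega$ is called sesqui-holomorphic if it is holomorphic in $z$ and anti-holomorphic in $w$ (that is, $(z,v)\mapsto F(z,\bar v)$ is holomorphic on $\Omega\times\{v:\bar v\in\Omega\}$). A scalar (or $k\times k$ matrix valued) function $F$ on $\Omega\times\Omega$ is a positive definite kernel on $\Omega$ if for all $u_1,\dots,u_n\in\Omega$ the (block) matrix $\big(F(u_a,u_b)\big)_{a,b=1}^n$ is Hermitian and nonnegative definite. A real analytic (matrix valued) function $G$ on $\Omega$ is a *positive definite function* on $\Omega$ if it has a polarization $\widetilde G$ on $\Omega\times\Omega$ (the unique sesqui-holomorphic function with $\widetilde G(w,w)=G(w)$ for $w\in\Omega$) and $\widetilde G$ is a positive definite kernel on $\Omega$. An *infinitely divisible kernel* on $\Omega$ is a sesqui-holomorphic positive definite kernel $K$ on $\Omega\times\Omega$ with $K(w,w)>0$ for $w\in\Omega$ such that for every real $t>0$ the power $K^t$ exists and is a positive definite kernel on $\Omega$, where $K^t$ denotes the unique sesqui-holomorphic function on $\Omega\times\Omega$ with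 $K^t(w,w)=K(w,w)^t$ for $w\in\Omega$. **Theorem.** 1. If $K$ is an infinitely divisible kernel on $\Omega$, then there is a domain $\Omega_0\subseteq\Omega$ such that the curvature matrix $\Big(\dfrac{\partial^2}{\partial w_i\,\partial\bar w_j}\log K(w,w)\Big)_{i,j=1}^m$ is a positive definite function on $\Omega_0$. 2. Conversely, let $\hat K$ be a positive real analytic function on $\Omega$ (a function of $w,\bar w$, written $\hat K(w,w)$) such that $\Big(\dfrac{\partial^2}{\partial w_i\,\partial\bar w_j}\log \hat K(w,w)\Big)_{i,j=1}^m$ is a positive definite function on $\Omega$. Then for every $w_0\in\Omega$ there are a domain $\Omega_0$ with $w_0\in\Omega_0\subseteq\Omega$ and an infinitely divisible kernel $K$ on $\Omega_0$ such that $K(w,w)=\hat K(w,w)$ for all $w\in\Omega_0$. -/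

import Mathlib

open scoped ComplexOrder

/-- A domain in `ℂ^m`: a nonempty, open, connected set. -/
def IsComplexDomain {m : ℕ} (Ω : Set (Fin m → ℂ)) : Prop :=
  IsOpen Ω ∧ IsConnected Ω

/-- `K(z, w)` is holomorphic in `z` and anti-holomorphic in `w` on `Ω × Ω`: the function
`(z, v) ↦ K(z, v̄)` is holomorphic (that is, complex analytic) on `Ω × {v | v̄ ∈ Ω}`.
Here `star` is coordinatewise complex conjugation. -/
def IsSesquiholomorphicOn {m : ℕ} (Ω : Set (Fin m → ℂ))
    (K : (Fin m → ℂ) → (Fin m → ℂ) → ℂ) : Prop :=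
  AnalyticOnNhd ℂ (fun p : (Fin m → ℂ) × (Fin m → ℂ) => K p.1 (star p.2))
    {p | p.1 ∈ Ω ∧ star p.2 ∈ Ω}

/-- A scalar kernel is positive definite on `Ω` if all the matrices `(K(u_a, u_b))_{a,b}` with
`u_1, …, u_n ∈ Ω` are Hermitian and nonnegative definite. -/
def IsPosDefKernelOn {m : ℕ} (Ω : Set (Fin m → ℂ))
    (K : (Fin m → ℂ) → (Fin m → ℂ) → ℂ) : Prop :=
  ∀ (n : ℕ) (u : Fin n → Fin m → ℂ), (∀ a, u a ∈ Ω) →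
    (Matrix.of fun a b : Fin n => K (u a) (u b)).PosSemidef

/-- A matrix-valued kernel is positive definite on `Ω` if all the block matrices
`(G(u_a, u_b))_{a,b}` with `u_1, …, u_n ∈ Ω` are Hermitian and nonnegative definite, that is,
`∑_{a,b} ⟨G(u_a, u_b) ξ_b, ξ_a⟩ ≥ 0` for all vectors `ξ_1, …, ξ_n`. -/
def IsPosDefMatrixKernelOn {m k : ℕ} (Ω : Set (Fin m → ℂ))
    (G : (Fin m → ℂ) → (Fin m → ℂ) → Matrix (Fin k) (Fin k) ℂ) : Prop :=
  ∀ (n : ℕ) (u : Fin n → Fin m → ℂ), (∀ a, u a ∈ Ω) →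
    (Matrix.of fun p q : Fin n × Fin k => G (u p.1) (u q.1) p.2 q.2).PosSemidef

/-- A matrix-valued function `G` on `Ω` is a positive definite function if its polarization, the
sesqui-holomorphic function on `Ω × Ω` that restricts to `G` on the diagonal (it is unique when
`Ω` is a domain), is a positive definite kernel. -/
def IsPosDefFunctionOn {m k : ℕ} (Ω : Set (Fin m → ℂ))
    (G : (Fin m → ℂ) → Matrix (Fin k) (Fin k) ℂ) : Prop :=
  ∃ P : (Fin m → ℂ) → (Fin m → ℂ) → Matrix (Fin k) (Fin k) ℂ,
    (∀ i j, IsSesquiholomorphicOn Ω fun z w => P z w i j) ∧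
    (∀ w ∈ Ω, P w w = G w) ∧
    IsPosDefMatrixKernelOn Ω P

/-- `P` is the power `K^t` of the kernel `K` on `Ω × Ω`: the sesqui-holomorphic function with
`P(w, w) = K(w, w)^t` (the power of a positive real number) on the diagonal. On a domain there is
at most one, and it is `exp (t log K)` whenever `K` has a sesqui-holomorphic logarithm that is
real on the diagonal. -/
def IsKernelPowerOn {m : ℕ} (Ω : Set (Fin m → ℂ)) (K : (Fin m → ℂ) → (Fin m → ℂ) → ℂ)
    (t : ℝ) (P : (Fin m → ℂ) → (Fin m → ℂ) → ℂ) : Prop :=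
  IsSesquiholomorphicOn Ω P ∧ ∀ w ∈ Ω, P w w = (((K w w).re ^ t : ℝ) : ℂ)

/-- An infinitely divisible kernel: a sesqui-holomorphic positive definite kernel on `Ω × Ω`,
positive on the diagonal, all of whose powers `K^t`, `t > 0`, are positive definite on `Ω`. -/
structure IsInfinitelyDivisibleKernelOn {m : ℕ} (Ω : Set (Fin m → ℂ))
    (K : (Fin m → ℂ) → (Fin m → ℂ) → ℂ) : Prop where
  sesquiholomorphic : IsSesquiholomorphicOn Ω K
  posDef : IsPosDefKernelOn Ω K
  diag_pos : ∀ w ∈ Ω, 0 < (K w w).re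
  pow_posDef : ∀ t : ℝ, 0 < t →
    ∃ P : (Fin m → ℂ) → (Fin m → ℂ) → ℂ, IsKernelPowerOn Ω K t P ∧ IsPosDefKernelOn Ω P

/-- The Wirtinger derivative `∂f/∂w_i = (∂f/∂x_i - i ∂f/∂y_i) / 2`. -/
noncomputable def wirtinger {m : ℕ} (i : Fin m) (f : (Fin m → ℂ) → ℂ) (w : Fin m → ℂ) : ℂ :=
  (fderiv ℝ f w (Pi.single i 1) - Complex.I * fderiv ℝ f w (Pi.single i Complex.I)) / 2

/-- The Wirtinger derivative `∂f/∂w̄_j = (∂f/∂x_j + i ∂f/∂y_j) / 2`. -/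
noncomputable def wirtingerBar {m : ℕ} (j : Fin m) (f : (Fin m → ℂ) → ℂ) (w : Fin m → ℂ) : ℂ :=
  (fderiv ℝ f w (Pi.single j 1) + Complex.I * fderiv ℝ f w (Pi.single j Complex.I)) / 2

/-- The curvature matrix `(∂²/∂w_i ∂w̄_j log F(w))_{i,j}` of a positive function `F`. -/
noncomputable def curvatureMatrix {m : ℕ} (F : (Fin m → ℂ) → ℝ) (w : Fin m → ℂ) :
    Matrix (Fin m) (Fin m) ℂ :=
  Matrix.of fun i j => wirtinger i (wirtingerBar j fun v => ((Real.log (F v) : ℝ) : ℂ)) w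

/-! Near a point write the kernel as `exp L`, where `L(z, v)` is holomorphic and real on the set `v
= w̄`, `z = w`. The curvature matrix is then the mixed derivative of `L` in `z` and `v`, restricted
to that set. Both halves of the theorem thus relate positivity of `exp (t L)` for all `t > 0` to
positivity of the mixed derivative of `L`.

From `exp (t L)` to the curvature: second differences of a positive definite kernel are positive
semidefinite. For `exp (t L)` the constants cancel, so dividing by `t` and letting `t → 0` gives the
same for second differences of `L`. Dividing these by `h ^ 2`, where `h` is the step, and letting `h
→ 0` gives the mixed derivative (`isPosDefMatrixKernelOn_mixedDeriv`).

From the curvature back: integrating the mixed derivative along segments from `w₀` shows that `L(z,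
w̄) - L(z, w̄₀) - L(w₀, w̄) + L(w₀, w̄₀)` is positive definite, as a limit of Riemann sums
(`isPosDefKernelOn_normalization`). Its multiples by `t > 0` can be exponentiated by the Schur
product theorem. The terms removed from `L` have the form `f(z) + conj f(w)`, so restoring them only
multiplies the kernel by `g(z) conj g(w)`.

The identity theorem `eqOn_zero_of_diagonal` matches the given powers and polarizations with those
built from `L`. Working on balls makes everything convex. -/

/-! ### Positive semidefinite matrices: limits, congruences, Schur products. -/

open Filter Topology in
theorem Matrix.PosSemidef.of_tendsto {κ ι : Type*} [Fintype ι] {l : Filter κ} [l.NeBot]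
    {A : κ → Matrix ι ι ℂ} {B : Matrix ι ι ℂ}
    (hAB : ∀ i j, Tendsto (fun k => A k i j) l (𝓝 (B i j)))
    (hA : ∀ᶠ k in l, (A k).PosSemidef) : B.PosSemidef := by
  refine Matrix.PosSemidef.of_dotProduct_mulVec_nonneg ?_ fun x => ?_
  · ext i j
    refine tendsto_nhds_unique (f := fun k => star (A k j i)) (l := l) ((hAB j i).star) ?_
    refine (hAB i j).congr' ?_
    filter_upwards [hA] with k hk
    exact (hk.isHermitian.apply i j).symm
  · have h : Tendsto (fun k => star x ⬝ᵥ (A k).mulVec x) l (𝓝 (star x ⬝ᵥ B.mulVec x)) := by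
      simp only [dotProduct, Matrix.mulVec]
      exact tendsto_finsetSum _ fun i _ => tendsto_const_nhds.mul
        (tendsto_finsetSum _ fun j _ => (hAB i j).mul tendsto_const_nhds)
    refine ge_of_tendsto h ?_
    filter_upwards [hA] with k hk
    exact hk.dotProduct_mulVec_nonneg x

theorem Matrix.PosSemidef.congruence {ι κ : Type*} [Fintype ι] [Fintype κ]
    {A : Matrix κ κ ℂ} (hA : A.PosSemidef) (c : ι → κ → ℂ) :
    (Matrix.of fun p q : ι => ∑ r, ∑ s, c p r * A r s * star (c q s)).PosSemidef := by
  convert! hA.mul_mul_conjTranspose_same (Matrix.of c) using 1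
  ext p q
  simp only [Matrix.of_apply, Matrix.mul_apply, Matrix.conjTranspose_apply, Finset.sum_mul]
  rw [Finset.sum_comm]

theorem Matrix.PosSemidef.mul_star {ι : Type*} [Fintype ι]
    {A : Matrix ι ι ℂ} (hA : A.PosSemidef) (c : ι → ℂ) :
    (Matrix.of fun p q : ι => c p * A p q * star (c q)).PosSemidef := by
  classical
  convert! hA.congruence (fun p r => if p = r then c p else 0) using 1
  ext p q
  simp [apply_ite]

theorem Matrix.PosSemidef.map_pow {ι : Type*} [Fintype ι]
    {A : Matrix ι ι ℂ} (hA : A.PosSemidef) (k : ℕ) :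
    (Matrix.of fun p q : ι => A p q ^ k).PosSemidef := by
  induction k with
  | zero =>
    -- The zeroth power is the all-ones matrix, a pullback of the `1 × 1` identity.
    convert! (Matrix.PosSemidef.one (n := Unit) (R := ℂ)).submatrix (fun _ : ι => ()) using 1
  | succ k ih =>
    convert! ih.hadamard hA using 1

-- The exponential series has nonnegative coefficients, and entrywise powers stay positive
-- semidefinite by the Schur product theorem.
open Filter Topology in
theorem Matrix.PosSemidef.map_cexp {ι : Type*} [Fintype ι]
    {A : Matrix ι ι ℂ} (hA : A.PosSemidef) :
    (Matrix.of fun p q : ι => Complex.exp (A p q)).PosSemidef := by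
  refine Matrix.PosSemidef.of_tendsto (l := atTop)
    (A := fun N : ℕ => ∑ k ∈ Finset.range N, ((k.factorial : ℝ)⁻¹) •
      (Matrix.of fun p q : ι => A p q ^ k)) (fun i j => ?_) (Eventually.of_forall fun N => ?_)
  · have h := (NormedSpace.expSeries_div_hasSum_exp (A i j)).tendsto_sum_nat
    rw [← Complex.exp_eq_exp_ℂ] at h
    refine h.congr fun N => ?_
    rw [Matrix.sum_apply]
    refine Finset.sum_congr rfl fun k _ => ?_
    simp [div_eq_inv_mul]
  · exact Matrix.posSemidef_sum _ fun k _ => (hA.map_pow k).smul (by positivity)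

/-! ### Kernels over finite index types, and the domain of polarizations. -/

theorem IsPosDefKernelOn.posSemidef {m : ℕ} {Ω : Set (Fin m → ℂ)}
    {K : (Fin m → ℂ) → (Fin m → ℂ) → ℂ} (hK : IsPosDefKernelOn Ω K) {ι : Type*} [Fintype ι]
    (u : ι → Fin m → ℂ) (hu : ∀ a, u a ∈ Ω) :
    (Matrix.of fun a b => K (u a) (u b)).PosSemidef := by
  convert! (hK _ (fun a => u ((Fintype.equivFin ι).symm a)) fun a => hu _).submatrix
    (Fintype.equivFin ι) using 1
  ext a b
  simp

theorem IsPosDefMatrixKernelOn.posSemidef {m k : ℕ} {Ω : Set (Fin m → ℂ)}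
    {G : (Fin m → ℂ) → (Fin m → ℂ) → Matrix (Fin k) (Fin k) ℂ}
    (hG : IsPosDefMatrixKernelOn Ω G) {ι : Type*} [Fintype ι]
    (u : ι → Fin m → ℂ) (hu : ∀ a, u a ∈ Ω) :
    (Matrix.of fun p q : ι × Fin k => G (u p.1) (u q.1) p.2 q.2).PosSemidef := by
  convert! (hG _ (fun a => u ((Fintype.equivFin ι).symm a)) fun a => hu _).submatrix
    (fun p : ι × Fin k => (Fintype.equivFin ι p.1, p.2)) using 1
  ext a b
  simp

theorem IsPosDefKernelOn.mono {m : ℕ} {Ω Ω₀ : Set (Fin m → ℂ)}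
    {K : (Fin m → ℂ) → (Fin m → ℂ) → ℂ} (hK : IsPosDefKernelOn Ω K) (h : Ω₀ ⊆ Ω) :
    IsPosDefKernelOn Ω₀ K :=
  fun n u hu => hK n u fun a => h (hu a)

theorem IsPosDefMatrixKernelOn.mono {m k : ℕ} {Ω Ω₀ : Set (Fin m → ℂ)}
    {G : (Fin m → ℂ) → (Fin m → ℂ) → Matrix (Fin k) (Fin k) ℂ}
    (hG : IsPosDefMatrixKernelOn Ω G) (h : Ω₀ ⊆ Ω) : IsPosDefMatrixKernelOn Ω₀ G :=
  fun n u hu => hG n u fun a => h (hu a)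

/-- The set of `(z, v)` with `z ∈ Ω` and `v̄ ∈ Ω`. -/
def conjDouble {m : ℕ} (Ω : Set (Fin m → ℂ)) : Set ((Fin m → ℂ) × (Fin m → ℂ)) :=
  {p | p.1 ∈ Ω ∧ star p.2 ∈ Ω}

theorem conjDouble_mono {m : ℕ} {Ω Ω₀ : Set (Fin m → ℂ)} (h : Ω₀ ⊆ Ω) :
    conjDouble Ω₀ ⊆ conjDouble Ω :=
  fun _ hp => ⟨h hp.1, h hp.2⟩

theorem IsSesquiholomorphicOn.mono {m : ℕ} {Ω Ω₀ : Set (Fin m → ℂ)}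
    {K : (Fin m → ℂ) → (Fin m → ℂ) → ℂ} (hK : IsSesquiholomorphicOn Ω K) (h : Ω₀ ⊆ Ω) :
    IsSesquiholomorphicOn Ω₀ K :=
  AnalyticOnNhd.mono hK (conjDouble_mono h)

theorem isOpen_conjDouble {m : ℕ} {Ω : Set (Fin m → ℂ)} (h : IsOpen Ω) :
    IsOpen (conjDouble Ω) :=
  (h.preimage continuous_fst).inter (h.preimage (continuous_star.comp continuous_snd))

theorem convex_conjDouble {m : ℕ} {Ω : Set (Fin m → ℂ)} (h : Convex ℝ Ω) :
    Convex ℝ (conjDouble Ω) := by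
  intro p hp q hq a b ha hb hab
  refine ⟨h hp.1 hq.1 ha hb hab, ?_⟩
  have := h hp.2 hq.2 ha hb hab
  rwa [show star ((a • p + b • q).2) = a • star p.2 + b • star q.2 by simp]

/-! ### Identity theorem for polarizations. -/

/-- A holomorphic function on a convex domain that vanishes on `{(w, w̄)}` is zero. -/
theorem eqOn_zero_of_diagonal {m : ℕ} {Ω : Set (Fin m → ℂ)} (ho : IsOpen Ω) (hc : Convex ℝ Ω)
    {F : (Fin m → ℂ) × (Fin m → ℂ) → ℂ} (hF : DifferentiableOn ℂ F (conjDouble Ω))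
    (h0 : ∀ w ∈ Ω, F (w, star w) = 0) {x : (Fin m → ℂ) × (Fin m → ℂ)} (hx : x ∈ conjDouble Ω) :
    F x = 0 := by
  -- `p` and `q` are chosen so that the complex line `c` lies in `{(w, w̄)}` for real `t` and passes
  -- through `x` at `t = I`. The one-variable identity theorem along `c` then suffices.
  set p : Fin m → ℂ := (2⁻¹ : ℝ) • (x.1 + star x.2) with hp
  set q : Fin m → ℂ := (2⁻¹ * -Complex.I) • (x.1 - star x.2) with hq
  let c : ℂ → (Fin m → ℂ) × (Fin m → ℂ) := fun t => (p, star p) + t • (q, star q)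
  have hcd : Differentiable ℂ c := by fun_prop
  have hpΩ : p ∈ Ω := by
    have := hc hx.1 hx.2 (a := 2⁻¹) (b := 2⁻¹) (by norm_num) (by norm_num) (by norm_num)
    rwa [hp, smul_add]
  have hcI : c Complex.I = x := by
    ext j
    · simp [c, hp, hq]
      linear_combination (-2⁻¹ * (x.1 j - (starRingEnd ℂ) (x.2 j))) * Complex.I_sq
    · simp [c, hp, hq]
      linear_combination (2⁻¹ * ((starRingEnd ℂ) (x.1 j) - (x.2 j))) * Complex.I_sq
  set U : Set ℂ := c ⁻¹' conjDouble Ω with hU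
  have hUo : IsOpen U := (isOpen_conjDouble ho).preimage hcd.continuous
  have hUc : Convex ℝ U := by
    intro s hs t ht a b ha hb hab
    have := convex_conjDouble hc hs ht ha hb hab
    rw [hU, Set.mem_preimage]
    convert this using 1
    have hab' : (b : ℝ) = 1 - a := by linarith
    subst hab'
    simp only [c]
    ext j <;> simp <;> ring
  have hg : AnalyticOnNhd ℂ (F ∘ c) U :=
    (hF.comp hcd.differentiableOn fun t ht => ht).analyticOnNhd hUo
  have h0U : (0 : ℂ) ∈ U := by simpa [hU, c, conjDouble] using hpΩ
  have hreal : ∀ t : ℝ, (t : ℂ) ∈ U → (F ∘ c) t = 0 := by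
    intro t ht
    have : c t = (p + (t : ℂ) • q, star (p + (t : ℂ) • q)) := by simp [c]
    have h1 : p + (t : ℂ) • q ∈ Ω := by
      have := ht.1
      simpa [c] using this
    simp only [Function.comp, this]
    exact h0 _ h1
  have hfreq : ∃ᶠ t in nhdsWithin (0 : ℂ) {0}ᶜ, (F ∘ c) t = 0 := by
    have h1 : Filter.Tendsto (fun t : ℝ => (t : ℂ)) (nhdsWithin 0 {0}ᶜ)
        (nhdsWithin (0 : ℂ) {0}ᶜ) := by
      refine tendsto_nhdsWithin_iff.2 ⟨?_, ?_⟩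
      · exact (Complex.continuous_ofReal.tendsto' 0 0 (by simp)).mono_left nhdsWithin_le_nhds
      · filter_upwards [self_mem_nhdsWithin] with t ht
        simpa using ht
    refine h1.frequently (Filter.Eventually.frequently ?_)
    have h2 : ∀ᶠ t in nhdsWithin (0 : ℂ) {0}ᶜ, t ∈ U :=
      nhdsWithin_le_nhds (hUo.mem_nhds h0U)
    filter_upwards [h1.eventually h2] with t ht using hreal t ht
  have hz := hg.eqOn_zero_of_preconnected_of_frequently_eq_zero hUc.isPreconnected h0U hfreq
  have hIU : Complex.I ∈ U := by simpa [hU, hcI] using hx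
  have := hz hIU
  simpa [hcI] using this

/-! ### Mixed derivatives and second differences. -/

/-- The mixed second derivative of `M(z, v)`, along `y` in `v` and then along `x` in `z`. -/
noncomputable def mixedDeriv {E : Type*} [NormedAddCommGroup E] [NormedSpace ℂ E]
    (M : E × E → ℂ) (x y : E) (p : E × E) : ℂ :=
  fderiv ℂ (fun q => fderiv ℂ M q (0, y)) p (x, 0)

section MixedDeriv

variable {E : Type*} [NormedAddCommGroup E] [NormedSpace ℂ E] {M : E × E → ℂ} {U : Set (E × E)}

theorem AnalyticOnNhd.fderiv_apply (hM : AnalyticOnNhd ℂ M U) (y : E × E) :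
    AnalyticOnNhd ℂ (fun q => fderiv ℂ M q y) U :=
  fun p hp => (ContinuousLinearMap.apply ℂ ℂ y).analyticAt _ |>.comp (hM.fderiv p hp)

theorem AnalyticOnNhd.mixedDeriv (hM : AnalyticOnNhd ℂ M U) (x y : E) :
    AnalyticOnNhd ℂ (mixedDeriv M x y) U :=
  (hM.fderiv_apply (0, y)).fderiv_apply (x, 0)

theorem mixedDeriv_smul (hM : AnalyticOnNhd ℂ M U) {p : E × E} (hp : p ∈ U) (a b : ℂ) (x y : E) :
    mixedDeriv M (a • x) (b • y) p = a * b * mixedDeriv M x y p := by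
  have h : (fun q => fderiv ℂ M q (0, b • y)) = fun q => b * fderiv ℂ M q (0, y) := by
    ext q
    rw [show ((0 : E), b • y) = b • ((0 : E), y) by simp, map_smul, smul_eq_mul]
  have hx : (a • x, (0 : E)) = a • (x, (0 : E)) := by simp
  rw [mixedDeriv, h, fderiv_const_mul ((hM.fderiv_apply (0, y) p hp).differentiableAt), hx]
  rw [map_smul]
  simp [mixedDeriv]
  ring

/-- If the mixed derivative is within `ε` of `c` on a parallelogram, so is the second
difference. -/
theorem norm_secondDifference_sub_le (hM : AnalyticOnNhd ℂ M U) {z x v y : E} {c : ℂ} {ε : ℝ}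
    (hU : ∀ s ∈ Set.Icc (0 : ℝ) 1, ∀ t ∈ Set.Icc (0 : ℝ) 1, (z + (s : ℂ) • x, v + (t : ℂ) • y) ∈ U)
    (hc : ∀ s ∈ Set.Icc (0 : ℝ) 1, ∀ t ∈ Set.Icc (0 : ℝ) 1,
      ‖mixedDeriv M x y (z + (s : ℂ) • x, v + (t : ℂ) • y) - c‖ ≤ ε) :
    ‖M (z + x, v + y) - M (z + x, v) - M (z, v + y) + M (z, v) - c‖ ≤ ε := by
  have hline1 : ∀ (w : E) (s : ℝ),
      HasDerivAt (fun s : ℝ => (z + (s : ℂ) • x, w)) (x, 0) s := fun w s => by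
    have h1 : HasDerivAt (fun s : ℝ => (s : ℂ)) 1 s := Complex.ofRealCLM.hasDerivAt
    have h2 : HasDerivAt (fun s : ℝ => z + (s : ℂ) • x) x s := by
      simpa using (h1.smul_const x).const_add z
    exact h2.prodMk (hasDerivAt_const s w)
  have hline2 : ∀ (w : E) (s : ℝ),
      HasDerivAt (fun s : ℝ => (w, v + (s : ℂ) • y)) (0, y) s := fun w s => by
    have h1 : HasDerivAt (fun s : ℝ => (s : ℂ)) 1 s := Complex.ofRealCLM.hasDerivAt
    have h2 : HasDerivAt (fun s : ℝ => v + (s : ℂ) • y) y s := by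
      simpa using (h1.smul_const y).const_add v
    exact (hasDerivAt_const s w).prodMk h2
  have hcomp : ∀ (F : E × E → ℂ) (γ : ℝ → E × E) (γ' : E × E) (s : ℝ), DifferentiableAt ℂ F (γ s) →
      HasDerivAt γ γ' s → HasDerivAt (fun s => F (γ s)) (fderiv ℂ F (γ s) γ') s :=
    fun F γ γ' s hF hγ =>
      (hF.hasFDerivAt.restrictScalars ℝ).comp_hasDerivAt s hγ
  have h0 : (0 : ℝ) ∈ Set.Icc (0 : ℝ) 1 := by simp
  have h1 : (1 : ℝ) ∈ Set.Icc (0 : ℝ) 1 := by simp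
  -- The mean value inequality is used twice, here in `z` and afterwards in `v`. Subtracting a
  -- linear term with slope `c` turns closeness to `c` into a bound on a derivative.
  have inner : ∀ t ∈ Set.Icc (0 : ℝ) 1,
      ‖fderiv ℂ M (z + x, v + (t : ℂ) • y) (0, y) - fderiv ℂ M (z, v + (t : ℂ) • y) (0, y) - c‖
        ≤ ε := by
    intro t ht
    have := norm_image_sub_le_of_norm_deriv_le_segment_01' (C := ε)
      (f := fun s : ℝ => fderiv ℂ M (z + (s : ℂ) • x, v + (t : ℂ) • y) (0, y) - (s : ℂ) * c)
      (f' := fun s : ℝ => mixedDeriv M x y (z + (s : ℂ) • x, v + (t : ℂ) • y) - c)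
      (fun s hs => by
        refine (HasDerivAt.sub ?_ ?_).hasDerivWithinAt
        · exact hcomp _ _ _ s (hM.fderiv_apply (0, y) _ (hU s hs t ht)).differentiableAt
            (hline1 _ s)
        · simpa using (Complex.ofRealCLM.hasDerivAt (x := s)).mul_const c)
      (fun s hs => hc s (Set.Ico_subset_Icc_self hs) t ht)
    convert! this using 2
    simp
    ring
  have := norm_image_sub_le_of_norm_deriv_le_segment_01' (C := ε)
      (f := fun t : ℝ => M (z + x, v + (t : ℂ) • y) - M (z, v + (t : ℂ) • y) - (t : ℂ) * c)
      (f' := fun t : ℝ => fderiv ℂ M (z + x, v + (t : ℂ) • y) (0, y)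
        - fderiv ℂ M (z, v + (t : ℂ) • y) (0, y) - c)
      (fun t ht => by
        refine (HasDerivAt.sub (HasDerivAt.sub ?_ ?_) ?_).hasDerivWithinAt
        · exact hcomp _ _ _ t (hM _ (by simpa using hU 1 h1 t ht)).differentiableAt (hline2 _ t)
        · exact hcomp _ _ _ t (hM _ (by simpa using hU 0 h0 t ht)).differentiableAt (hline2 _ t)
        · simpa using (Complex.ofRealCLM.hasDerivAt (x := t)).mul_const c)
      (fun t ht => inner t (Set.Ico_subset_Icc_self ht))
  convert! this using 2
  simp
  ring

open Filter Topology in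
/-- The mixed derivative is the limit of second difference quotients. -/
theorem tendsto_secondDifference (hM : AnalyticOnNhd ℂ M U) (hUo : IsOpen U) {z v : E}
    (hp : (z, v) ∈ U) (x y : E) :
    Tendsto (fun h : ℝ => ((h ^ 2)⁻¹ : ℝ) * (M (z + (h : ℂ) • x, v + (h : ℂ) • y)
      - M (z + (h : ℂ) • x, v) - M (z, v + (h : ℂ) • y) + M (z, v))) (𝓝[>] 0)
      (𝓝 (mixedDeriv M x y (z, v))) := by
  rw [Metric.tendsto_nhds]
  intro ε hε
  have hcont := (hM.mixedDeriv x y (z, v) hp).continuousAt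
  have h1 : ∀ᶠ p in 𝓝 (z, v), p ∈ U ∧ ‖mixedDeriv M x y p - mixedDeriv M x y (z, v)‖ ≤ ε / 2 := by
    refine Filter.Eventually.and (hUo.mem_nhds hp) ?_
    filter_upwards [Metric.continuousAt_iff'.1 hcont (ε / 2) (by positivity)] with p hp
    rw [← dist_eq_norm]
    exact hp.le
  have hl : Continuous fun a : ℝ × ℝ => (z + (a.1 : ℂ) • x, v + (a.2 : ℂ) • y) := by fun_prop
  have h2 := (hl.tendsto' (0, 0) (z, v) (by simp)).eventually h1
  obtain ⟨δ, hδ, hball⟩ := Metric.eventually_nhds_iff.1 h2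
  filter_upwards [Ioo_mem_nhdsGT hδ] with h hh
  have hh0 : (h : ℂ) ≠ 0 := by exact_mod_cast hh.1.ne'
  have hin : ∀ s ∈ Set.Icc (0 : ℝ) 1, |s * h| < δ := fun s hs => by
    rw [abs_of_nonneg (mul_nonneg hs.1 hh.1.le)]
    nlinarith [hs.1, hs.2, hh.1, hh.2]
  have key : ∀ s ∈ Set.Icc (0 : ℝ) 1, ∀ t ∈ Set.Icc (0 : ℝ) 1,
      (z + (s : ℂ) • (h : ℂ) • x, v + (t : ℂ) • (h : ℂ) • y) ∈ U ∧
      ‖mixedDeriv M x y (z + (s : ℂ) • (h : ℂ) • x, v + (t : ℂ) • (h : ℂ) • y)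
        - mixedDeriv M x y (z, v)‖ ≤ ε / 2 := fun s hs t ht => by
    have := @hball (s * h, t * h) (by
      rw [Prod.dist_eq, max_lt_iff]
      simpa only [sub_zero, Real.dist_eq] using ⟨hin s hs, hin t ht⟩)
    simpa only [smul_smul, Complex.ofReal_mul] using this
  have := norm_secondDifference_sub_le hM (z := z) (v := v) (x := (h : ℂ) • x) (y := (h : ℂ) • y)
    (c := (h : ℂ) * h * mixedDeriv M x y (z, v)) (ε := h ^ 2 * (ε / 2))
    (fun s hs t ht => (key s hs t ht).1) (fun s hs t ht => by
      rw [mixedDeriv_smul hM (key s hs t ht).1, ← mul_sub, norm_mul, norm_mul, Complex.norm_real,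
        Real.norm_of_nonneg hh.1.le, ← pow_two]
      exact mul_le_mul_of_nonneg_left (key s hs t ht).2 (by positivity))
  rw [dist_eq_norm]
  set Δ := M (z + (h : ℂ) • x, v + (h : ℂ) • y)
      - M (z + (h : ℂ) • x, v) - M (z, v + (h : ℂ) • y) + M (z, v)
  have e : ((h ^ 2)⁻¹ : ℝ) * Δ - mixedDeriv M x y (z, v)
      = ((h ^ 2)⁻¹ : ℝ) * (Δ - (h : ℂ) * h * mixedDeriv M x y (z, v)) := by
    push_cast
    field_simp
  rw [e, norm_mul, Complex.norm_real, Real.norm_of_nonneg (by positivity)]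
  calc (h ^ 2)⁻¹ * _ ≤ (h ^ 2)⁻¹ * (h ^ 2 * (ε / 2)) := by gcongr
    _ = ε / 2 := by field_simp [hh.1.ne']
    _ < ε := by linarith

open Filter Topology in
/-- Riemann sums of the mixed derivative converge to the second difference. -/
theorem tendsto_riemannSum_mixedDeriv (hM : AnalyticOnNhd ℂ M U) {z x v y : E}
    (hU : ∀ s ∈ Set.Icc (0 : ℝ) 1, ∀ t ∈ Set.Icc (0 : ℝ) 1,
      (z + (s : ℂ) • x, v + (t : ℂ) • y) ∈ U) :
    Tendsto (fun N : ℕ => ∑ k : Fin N, ∑ l : Fin N, ((N : ℂ)⁻¹ * (N : ℂ)⁻¹) *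
        mixedDeriv M x y (z + ((k / N : ℝ) : ℂ) • x, v + ((l / N : ℝ) : ℂ) • y)) atTop
      (𝓝 (M (z + x, v + y) - M (z + x, v) - M (z, v + y) + M (z, v))) := by
  rw [Metric.tendsto_atTop]
  intro ε hε
  set g : ℝ × ℝ → ℂ := fun a => mixedDeriv M x y (z + (a.1 : ℂ) • x, v + (a.2 : ℂ) • y) with hg
  have hgc : ContinuousOn g (Set.Icc 0 1 ×ˢ Set.Icc 0 1) := by
    intro a ha
    have hl : Continuous fun a : ℝ × ℝ => (z + (a.1 : ℂ) • x, v + (a.2 : ℂ) • y) := by fun_prop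
    exact (ContinuousAt.comp (f := fun a : ℝ × ℝ => (z + (a.1 : ℂ) • x, v + (a.2 : ℂ) • y))
      (hM.mixedDeriv x y _ (hU _ ha.1 _ ha.2)).continuousAt hl.continuousAt).continuousWithinAt
  have huc := (isCompact_Icc.prod isCompact_Icc).uniformContinuousOn_of_continuous hgc
  obtain ⟨δ, hδ, huc⟩ := Metric.uniformContinuousOn_iff_le.1 huc (ε / 2) (by positivity)
  obtain ⟨N₀, hN₀⟩ := exists_nat_gt δ⁻¹
  refine ⟨N₀ + 1, fun N hN => ?_⟩
  have hNpos : (0 : ℝ) < N := by exact_mod_cast (by omega : 0 < N)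
  have hN0 : (N : ℂ) ≠ 0 := by exact_mod_cast hNpos.ne'
  have hNδ : 1 / (N : ℝ) ≤ δ := by
    have : (N₀ : ℝ) ≤ N := by exact_mod_cast (by omega : N₀ ≤ N)
    rw [one_div]
    exact inv_le_of_inv_le₀ hδ (by linarith)
  set f : ℕ → ℕ → ℂ := fun k l => M (z + ((k / N : ℝ) : ℂ) • x, v + ((l / N : ℝ) : ℂ) • y) with hf
  have hmem : ∀ k : Fin N, ∀ s ∈ Set.Icc (0 : ℝ) 1, (k / N : ℝ) + s / N ∈ Set.Icc (0 : ℝ) 1 := by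
    intro k s hs
    have hk : ((k : ℕ) : ℝ) + 1 ≤ N := by exact_mod_cast k.2
    refine ⟨add_nonneg (by positivity) (div_nonneg hs.1 hNpos.le), ?_⟩
    rw [← add_div, div_le_one hNpos]
    linarith [hs.2]
  have hmem0 : ∀ k : Fin N, (k / N : ℝ) ∈ Set.Icc (0 : ℝ) 1 := fun k => by
    simpa using hmem k 0 (by simp)
  -- On each of the `N ^ 2` cells the error is at most `N⁻² * (ε / 2)`, by uniform continuity; the
  -- cell differences telescope in both directions.
  have hcell : ∀ k l : Fin N, ‖f (k + 1) (l + 1) - f (k + 1) l - f k (l + 1) + f k l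
      - (N : ℂ)⁻¹ * (N : ℂ)⁻¹ * g (k / N, l / N)‖ ≤ (N : ℝ)⁻¹ * (N : ℝ)⁻¹ * (ε / 2) := by
    intro k l
    have hpt : ∀ (u x : E) (k : ℕ) (s : ℝ), u + ((k / N : ℝ) : ℂ) • x + (s : ℂ) • (N : ℂ)⁻¹ • x
        = u + (((k / N : ℝ) + s / N : ℝ) : ℂ) • x := fun u x k s => by
      rw [add_assoc, smul_smul, ← add_smul]
      push_cast
      rfl
    have hpt1 : ∀ (u x : E) (k : ℕ), u + ((k / N : ℝ) : ℂ) • x + (N : ℂ)⁻¹ • x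
        = u + ((((k + 1 : ℕ) : ℝ) / N : ℝ) : ℂ) • x := fun u x k => by
      rw [add_assoc, ← add_smul]
      push_cast
      rw [add_div, one_div]
    have := norm_secondDifference_sub_le hM (z := z + ((k / N : ℝ) : ℂ) • x)
      (v := v + ((l / N : ℝ) : ℂ) • y) (x := (N : ℂ)⁻¹ • x) (y := (N : ℂ)⁻¹ • y)
      (c := (N : ℂ)⁻¹ * (N : ℂ)⁻¹ * g (k / N, l / N)) (ε := (N : ℝ)⁻¹ * (N : ℝ)⁻¹ * (ε / 2))
      (fun s hs t ht => by
        rw [hpt, hpt]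
        exact hU _ (hmem k s hs) _ (hmem l t ht))
      (fun s hs t ht => by
        rw [hpt, hpt, mixedDeriv_smul hM (hU _ (hmem k s hs) _ (hmem l t ht)), ← mul_sub, norm_mul,
          norm_mul, norm_inv, Complex.norm_natCast]
        refine mul_le_mul_of_nonneg_left ?_ (by positivity)
        rw [← dist_eq_norm]
        refine huc ((k / N : ℝ) + s / N, (l / N : ℝ) + t / N) ⟨hmem k s hs, hmem l t ht⟩
          (k / N, l / N) ⟨hmem0 k, hmem0 l⟩ ?_
        have hs1 : ∀ s ∈ Set.Icc (0 : ℝ) 1, |s / (N : ℝ)| ≤ δ := fun s hs => by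
          rw [abs_of_nonneg (div_nonneg hs.1 hNpos.le)]
          exact (div_le_div_of_nonneg_right hs.2 hNpos.le).trans hNδ
        rw [Prod.dist_eq, max_le_iff, Real.dist_eq, Real.dist_eq]
        simpa using ⟨hs1 s hs, hs1 t ht⟩)
    simp only [hpt1] at this
    exact this
  have htel : M (z + x, v + y) - M (z + x, v) - M (z, v + y) + M (z, v)
      = ∑ k : Fin N, ∑ l : Fin N, (f (k + 1) (l + 1) - f (k + 1) l - f k (l + 1) + f k l) := by
    have hl : ∀ k : ℕ, ∑ l : Fin N, (f (k + 1) (l + 1) - f (k + 1) l - f k (l + 1) + f k l)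
        = (f (k + 1) N - f (k + 1) 0) - (f k N - f k 0) := fun k => by
      rw [Fin.sum_univ_eq_sum_range
        (fun l => f (k + 1) (l + 1) - f (k + 1) l - f k (l + 1) + f k l) N,
        ← Finset.sum_range_sub (f (k + 1)) N, ← Finset.sum_range_sub (f k) N,
        ← Finset.sum_sub_distrib]
      exact Finset.sum_congr rfl fun l _ => by ring
    rw [Finset.sum_congr rfl fun (k : Fin N) _ => hl k,
      Fin.sum_univ_eq_sum_range (fun k => (f (k + 1) N - f (k + 1) 0) - (f k N - f k 0)) N,
      Finset.sum_range_sub (fun k => f k N - f k 0) N]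
    simp [hf, div_self hN0]
    ring
  rw [htel, dist_comm, dist_eq_norm, ← Finset.sum_sub_distrib]
  calc _ ≤ ∑ k : Fin N, ∑ l : Fin N, (N : ℝ)⁻¹ * (N : ℝ)⁻¹ * (ε / 2) := by
        refine norm_sum_le_of_le _ fun k _ => ?_
        rw [← Finset.sum_sub_distrib]
        exact norm_sum_le_of_le _ fun l _ => hcell k l
    _ = ε / 2 := by
        simp
        field_simp
    _ < ε := by linarith

end MixedDeriv

/-! ### Polarization of real analytic functions. -/

/-- Every function that is real analytic at `w₀` extends to a holomorphic function of `(z, v)`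
near `(w₀, w̄₀)`. -/
theorem AnalyticAt.exists_polarization {m : ℕ} {φ : (Fin m → ℂ) → ℂ} {w₀ : Fin m → ℂ}
    (hφ : AnalyticAt ℝ φ w₀) : ∃ r > 0, ∃ M : (Fin m → ℂ) × (Fin m → ℂ) → ℂ,
      AnalyticOnNhd ℂ M (conjDouble (Metric.ball w₀ r)) ∧
      ∀ w ∈ Metric.ball w₀ r, M (w, star w) = φ w := by
  obtain ⟨p, R, hp⟩ := hφ
  -- `e` is the standard real basis of `ℂ^m`. The `ℓ i` extend its real coordinates holomorphically:
  -- `Re` becomes `(z + v) / 2` and `Im` becomes `(z - v) / (2i)`.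
  let e : Fin m × Bool → Fin m → ℂ := fun i => Pi.single i.1 (if i.2 then Complex.I else 1)
  let ℓ : Fin m × Bool → ((Fin m → ℂ) × (Fin m → ℂ) →L[ℂ] ℂ) := fun i =>
    let z := (ContinuousLinearMap.proj (R := ℂ) (φ := fun _ : Fin m => ℂ) i.1).comp
      (ContinuousLinearMap.fst ℂ (Fin m → ℂ) (Fin m → ℂ))
    let v := (ContinuousLinearMap.proj (R := ℂ) (φ := fun _ : Fin m => ℂ) i.1).comp
      (ContinuousLinearMap.snd ℂ (Fin m → ℂ) (Fin m → ℂ))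
    if i.2 then (-Complex.I * 2⁻¹) • (z - v) else (2⁻¹ : ℂ) • (z + v)
  let c : Fin m × Bool → (Fin m → ℂ) → ℝ := fun i y => if i.2 then (y i.1).im else (y i.1).re
  have hℓc : ∀ i y, ℓ i (y, star y) = c i y := by
    rintro ⟨j, b⟩ y
    cases b
    all_goals
      apply Complex.ext <;> simp [ℓ, c]
      ring
  have hsum : ∀ y, ∑ i, c i y • e i = y := by
    intro y
    ext j
    simp only [Fintype.sum_prod_type, Fintype.sum_bool, Finset.sum_apply, Pi.smul_apply]
    rw [Finset.sum_eq_single j]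
    · simp [c, e]
      rw [add_comm]
      exact Complex.re_add_im _
    · intro k _ hk
      simp [e, Pi.single_eq_of_ne' hk]
    · simp
  have he : ∀ i, ‖e i‖ ≤ 1 := by
    rintro ⟨j, b⟩
    cases b <;> simp [e, Pi.norm_single]
  have hℓ : ∀ i, ‖ℓ i‖ ≤ 1 := by
    rintro ⟨j, b⟩
    refine ContinuousLinearMap.opNorm_le_bound _ zero_le_one fun x => ?_
    have h1 : ‖x.1 j‖ ≤ ‖x‖ := (norm_le_pi_norm _ _).trans (norm_fst_le x)
    have h2 : ‖x.2 j‖ ≤ ‖x‖ := (norm_le_pi_norm _ _).trans (norm_snd_le x)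
    have h3 := norm_add_le (x.1 j) (x.2 j)
    have h4 := norm_sub_le (x.1 j) (x.2 j)
    cases b <;> simp [ℓ, ← mul_add] <;> linarith
  -- The real power series expanded in the basis `e`, with each real coordinate replaced by its
  -- extension `ℓ i`.
  let q : FormalMultilinearSeries ℂ ((Fin m → ℂ) × (Fin m → ℂ)) ℂ := fun n =>
    ∑ f : Fin n → Fin m × Bool, p n (fun k => e (f k)) •
      (ContinuousMultilinearMap.mkPiAlgebra ℂ (Fin n) ℂ).compContinuousLinearMap fun k => ℓ (f k)
  have hq : ∀ n (y : Fin m → ℂ), q n (fun _ => (y, star y)) = p n fun _ => y := by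
    intro n y
    conv_rhs => rw [← hsum y]
    rw [ContinuousMultilinearMap.map_sum]
    simp only [q, sum_apply, smul_apply,
      ContinuousMultilinearMap.compContinuousLinearMap_apply,
      ContinuousMultilinearMap.mkPiAlgebra_apply, ContinuousMultilinearMap.map_smul_univ, hℓc]
    refine Finset.sum_congr rfl fun f _ => ?_
    rw [smul_eq_mul, mul_comm, Complex.real_smul]
    push_cast
    rfl
  set d : ℝ := (Fintype.card (Fin m × Bool) : ℝ) with hd
  have hd0 : 0 ≤ d := by positivity
  have hqn : ∀ n, ‖q n‖ ≤ d ^ n * ‖p n‖ := by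
    intro n
    calc ‖q n‖ ≤ ∑ f : Fin n → Fin m × Bool, ‖p n‖ := by
          refine norm_sum_le_of_le _ fun f _ => ?_
          rw [norm_smul]
          have h1 : ‖p n fun k => e (f k)‖ ≤ ‖p n‖ := by
            refine ((p n).le_opNorm _).trans (mul_le_of_le_one_right (norm_nonneg _) ?_)
            exact Finset.prod_le_one (fun _ _ => norm_nonneg _) fun k _ => he _
          have h2 : ‖(ContinuousMultilinearMap.mkPiAlgebra ℂ (Fin n) ℂ).compContinuousLinearMap
              fun k => ℓ (f k)‖ ≤ 1 := by
            refine (ContinuousMultilinearMap.norm_compContinuousLinearMap_le _ _).trans ?_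
            rw [ContinuousMultilinearMap.norm_mkPiAlgebra, one_mul]
            exact Finset.prod_le_one (fun _ _ => norm_nonneg _) fun k _ => hℓ _
          simpa using mul_le_mul h1 h2 (norm_nonneg _) (norm_nonneg _)
      _ = d ^ n * ‖p n‖ := by simp [hd]
  obtain ⟨r₀, hr₀, hr₀R⟩ := ENNReal.lt_iff_exists_nnreal_btwn.1 hp.r_pos
  have hr₀pos : 0 < r₀ := by exact_mod_cast hr₀
  obtain ⟨C, -, hC⟩ := p.norm_mul_pow_le_of_lt_radius (hr₀R.trans_le hp.r_le)
  -- The expansion of `q n` has `d ^ n` terms, which costs a factor `d` in the radius; the `+ 1`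
  -- covers `m = 0`.
  set r : NNReal := r₀ / (Fintype.card (Fin m × Bool) + 1) with hr
  have hrpos : 0 < r := by positivity
  have hrr₀ : r ≤ r₀ := div_le_self zero_le (by simp)
  have hrad : (r : ENNReal) ≤ q.radius := by
    refine q.le_radius_of_bound C fun n => (le_trans ?_ (hC n))
    have hdr : d * r ≤ r₀ := by
      rw [hr]
      push_cast
      rw [← hd, ← mul_div_assoc, div_le_iff₀ (by positivity)]
      nlinarith [r₀.2]
    calc ‖q n‖ * (r : ℝ) ^ n ≤ d ^ n * ‖p n‖ * (r : ℝ) ^ n := by gcongr; exact hqn n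
      _ = ‖p n‖ * (d * r) ^ n := by ring
      _ ≤ ‖p n‖ * (r₀ : ℝ) ^ n := by gcongr
  have hqs := (q.hasFPowerSeriesOnBall ((ENNReal.coe_pos.2 hrpos).trans_le hrad)).mono
    (ENNReal.coe_pos.2 hrpos) hrad
  refine ⟨r, hrpos, fun x => q.sum (x - (w₀, star w₀)), fun x hx => ?_, fun w hw => ?_⟩
  · refine AnalyticAt.comp (g := q.sum) (f := fun x => x - (w₀, star w₀)) ?_ (by fun_prop)
    refine hqs.analyticAt_of_mem ?_
    have h1 := mem_ball_iff_norm.1 hx.1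
    have h2 := mem_ball_iff_norm.1 hx.2
    rw [← norm_star, star_sub, star_star] at h2
    rw [Metric.eball_coe, mem_ball_zero_iff, Prod.norm_def, max_lt_iff]
    exact ⟨h1, h2⟩
  · have hy := mem_ball_iff_norm.1 hw
    have h1 := hp.hasSum (y := w - w₀) (by
      refine Metric.eball_subset_eball hr₀R.le ?_
      rw [Metric.eball_coe, mem_ball_zero_iff]
      exact hy.trans_le (by exact_mod_cast hrr₀))
    have h2 := hqs.hasSum (y := (w, star w) - (w₀, star w₀)) (by
      rw [Metric.eball_coe, mem_ball_zero_iff, Prod.norm_def, max_lt_iff]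
      refine ⟨hy, ?_⟩
      simpa [← star_sub] using hy)
    rw [add_sub_cancel] at h1
    rw [zero_add] at h2
    refine h2.unique ?_
    convert! h1 using 2 with n
    rw [← hq]
    simp

/-! ### Wirtinger derivatives in polarized coordinates. -/

section Wirtinger

variable {m : ℕ} {M : (Fin m → ℂ) × (Fin m → ℂ) → ℂ} {f : (Fin m → ℂ) → ℂ} {w : Fin m → ℂ}

theorem fderiv_comp_star (hM : DifferentiableAt ℂ M (w, star w))
    (hf : f =ᶠ[nhds w] fun w => M (w, star w)) (h : Fin m → ℂ) :
    fderiv ℝ f w h = fderiv ℂ M (w, star w) (h, star h) := by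
  have h1 : HasFDerivAt (fun w : Fin m → ℂ => (w, star w))
      ((ContinuousLinearMap.id ℝ (Fin m → ℂ)).prod
        ((starL' ℝ : (Fin m → ℂ) ≃L[ℝ] (Fin m → ℂ)) : (Fin m → ℂ) →L[ℝ] (Fin m → ℂ))) w :=
    (ContinuousLinearMap.hasFDerivAt ((ContinuousLinearMap.id ℝ (Fin m → ℂ)).prod
        ((starL' ℝ : (Fin m → ℂ) ≃L[ℝ] (Fin m → ℂ)) : (Fin m → ℂ) →L[ℝ] (Fin m → ℂ))) :)
  have h2 := (hM.hasFDerivAt.restrictScalars ℝ).comp w h1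
  rw [hf.fderiv_eq]
  exact congrArg (fun D => D h) h2.fderiv

theorem single_I_eq_smul (i : Fin m) :
    (Pi.single i Complex.I : Fin m → ℂ) = Complex.I • Pi.single i 1 := by
  rw [← Pi.single_smul, smul_eq_mul, mul_one]

theorem star_single_one (i : Fin m) : star (Pi.single i 1 : Fin m → ℂ) = Pi.single i 1 := by
  rw [← Pi.single_star, star_one]

/-- Replacing the direction `e_i` by `I • e_i` multiplies the `z`-part of the derivative by `I` and
the `v`-part by `-I`, so the Wirtinger combination keeps only the `z`-part. -/
theorem wirtinger_eq_fderiv (hM : DifferentiableAt ℂ M (w, star w))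
    (hf : f =ᶠ[nhds w] fun w => M (w, star w)) (i : Fin m) :
    wirtinger i f w = fderiv ℂ M (w, star w) (Pi.single i 1, 0) := by
  have h : ∀ a b : Fin m → ℂ, (a, b) = (a, 0) + (0, b) := by simp
  rw [wirtinger, fderiv_comp_star hM hf, fderiv_comp_star hM hf, single_I_eq_smul, star_smul,
    star_single_one, h (Pi.single i 1), h (Complex.I • Pi.single i 1),
    show (Complex.I • (Pi.single i 1 : Fin m → ℂ), (0 : Fin m → ℂ))
      = Complex.I • (Pi.single i 1, 0) by simp,
    show ((0 : Fin m → ℂ), star Complex.I • (Pi.single i 1 : Fin m → ℂ))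
      = (-Complex.I) • (0, Pi.single i 1) by simp]
  simp only [map_add, map_smul, smul_eq_mul]
  ring_nf
  rw [Complex.I_sq]
  ring

theorem wirtingerBar_eq_fderiv (hM : DifferentiableAt ℂ M (w, star w))
    (hf : f =ᶠ[nhds w] fun w => M (w, star w)) (i : Fin m) :
    wirtingerBar i f w = fderiv ℂ M (w, star w) (0, Pi.single i 1) := by
  have h : ∀ a b : Fin m → ℂ, (a, b) = (a, 0) + (0, b) := by simp
  rw [wirtingerBar, fderiv_comp_star hM hf, fderiv_comp_star hM hf, single_I_eq_smul, star_smul,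
    star_single_one, h (Pi.single i 1), h (Complex.I • Pi.single i 1),
    show (Complex.I • (Pi.single i 1 : Fin m → ℂ), (0 : Fin m → ℂ))
      = Complex.I • (Pi.single i 1, 0) by simp,
    show ((0 : Fin m → ℂ), star Complex.I • (Pi.single i 1 : Fin m → ℂ))
      = (-Complex.I) • (0, Pi.single i 1) by simp]
  simp only [map_add, map_smul, smul_eq_mul]
  ring_nf
  rw [Complex.I_sq]
  ring

theorem curvatureMatrix_apply_eq_mixedDeriv {Ω : Set (Fin m → ℂ)} (ho : IsOpen Ω)
    (hM : AnalyticOnNhd ℂ M (conjDouble Ω)) {F : (Fin m → ℂ) → ℝ}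
    (hF : ∀ w ∈ Ω, M (w, star w) = (Real.log (F w) : ℝ)) (hw : w ∈ Ω) (i j : Fin m) :
    curvatureMatrix F w i j = mixedDeriv M (Pi.single i 1) (Pi.single j 1) (w, star w) := by
  have hmem : ∀ u ∈ Ω, (u, star u) ∈ conjDouble Ω := fun u hu => ⟨hu, by simpa using hu⟩
  refine wirtinger_eq_fderiv (hM.fderiv_apply _ _ (hmem w hw)).differentiableAt ?_ i
  filter_upwards [ho.mem_nhds hw] with u hu
  refine wirtingerBar_eq_fderiv (hM _ (hmem u hu)).differentiableAt ?_ j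
  filter_upwards [ho.mem_nhds hu] with v hv using (hF v hv).symm

theorem mixedDeriv_eq_sum {U : Set ((Fin m → ℂ) × (Fin m → ℂ))} (hM : AnalyticOnNhd ℂ M U)
    {p : (Fin m → ℂ) × (Fin m → ℂ)} (hp : p ∈ U) (x y : Fin m → ℂ) :
    mixedDeriv M x y p
      = ∑ i, ∑ j, x i * y j * mixedDeriv M (Pi.single i 1) (Pi.single j 1) p := by
  have hx : ((x, 0) : (Fin m → ℂ) × (Fin m → ℂ)) = ∑ i, x i • (Pi.single i 1, 0) := by
    ext j <;> simp [Prod.fst_sum, Prod.snd_sum, Finset.sum_apply, Pi.single_apply]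
  have hy : ((0, y) : (Fin m → ℂ) × (Fin m → ℂ)) = ∑ i, y i • (0, Pi.single i 1) := by
    ext j <;> simp [Prod.fst_sum, Prod.snd_sum, Finset.sum_apply, Pi.single_apply]
  have h : (fun q => fderiv ℂ M q (0, y))
      = fun q => ∑ j, y j * fderiv ℂ M q (0, Pi.single j 1) := by
    ext q
    rw [hy, map_sum]
    exact Finset.sum_congr rfl fun j _ => map_smul _ _ _
  have hd : ∀ j, DifferentiableAt ℂ (fun q => fderiv ℂ M q (0, Pi.single j 1)) p :=
    fun j => (hM.fderiv_apply _ p hp).differentiableAt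
  rw [mixedDeriv, h, fderiv_fun_sum fun j _ => (hd j).const_mul _, hx, map_sum]
  refine Finset.sum_congr rfl fun i _ => ?_
  rw [map_smul, sum_apply, Finset.smul_sum]
  refine Finset.sum_congr rfl fun j _ => ?_
  rw [fderiv_const_mul (hd j)]
  simp [mixedDeriv, mul_assoc]

end Wirtinger

/-! ### Positivity of `exp (t L)` and of the mixed derivative of `L`. -/

/-- Congruence of the kernel matrix at the points `u`, `v` by the block row `(1, -1)`. -/
theorem IsPosDefKernelOn.difference {m : ℕ} {Ω : Set (Fin m → ℂ)}
    {K : (Fin m → ℂ) → (Fin m → ℂ) → ℂ} (hK : IsPosDefKernelOn Ω K) {ι : Type*} [Fintype ι]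
    (u v : ι → Fin m → ℂ) (hu : ∀ a, u a ∈ Ω) (hv : ∀ a, v a ∈ Ω) :
    (Matrix.of fun a b =>
      K (u a) (u b) - K (u a) (v b) - K (v a) (u b) + K (v a) (v b)).PosSemidef := by
  classical
  have h := hK.posSemidef (Sum.elim u v) (by rintro (a | a) <;> simp [hu, hv])
  convert! h.congruence (fun a r => Sum.elim (fun b => if a = b then 1 else 0)
    (fun b => if a = b then -1 else 0) r) using 1
  ext a b
  simp [apply_ite (starRingEnd ℂ), Finset.sum_add_distrib]
  ring

open Filter Topology in
/-- If all `exp (t L)` are positive definite, then so is the mixed derivative of `L`. -/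
theorem isPosDefMatrixKernelOn_mixedDeriv {m : ℕ} {Ω : Set (Fin m → ℂ)} (ho : IsOpen Ω)
    {M : (Fin m → ℂ) × (Fin m → ℂ) → ℂ} (hM : AnalyticOnNhd ℂ M (conjDouble Ω))
    (hexp : ∀ t : ℝ, 0 < t → IsPosDefKernelOn Ω fun z w => Complex.exp (t * M (z, star w))) :
    IsPosDefMatrixKernelOn Ω fun z w => Matrix.of fun i j =>
      mixedDeriv M (Pi.single i 1) (Pi.single j 1) (z, star w) := by
  intro n u hu
  -- This is the derivative at `t = 0` of the second difference of `exp (t M)`, which vanishes at `t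
  -- = 0` because `1 - 1 - 1 + 1 = 0`.
  have hcond : ∀ (x y : Fin n × Fin m → Fin m → ℂ), (∀ a, x a ∈ Ω) → (∀ a, y a ∈ Ω) →
      (Matrix.of fun a b => M (x a, star (x b)) - M (x a, star (y b)) - M (y a, star (x b))
        + M (y a, star (y b))).PosSemidef := by
    intro x y hx hy
    refine Matrix.PosSemidef.of_tendsto (l := 𝓝[>] (0 : ℝ)) (A := fun t : ℝ => t⁻¹ •
      Matrix.of fun a b => Complex.exp (t * M (x a, star (x b)))
        - Complex.exp (t * M (x a, star (y b))) - Complex.exp (t * M (y a, star (x b)))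
        + Complex.exp (t * M (y a, star (y b)))) (fun a b => ?_) ?_
    · have h1 : ∀ X : ℂ, HasDerivAt (fun t : ℝ => Complex.exp (t * X)) X 0 := fun X => by
        have := ((Complex.ofRealCLM.hasDerivAt (x := (0 : ℝ))).mul_const X).cexp
        simpa using this
      have h2 := ((((h1 (M (x a, star (x b)))).sub (h1 (M (x a, star (y b))))).sub
        (h1 (M (y a, star (x b))))).add (h1 (M (y a, star (y b))))).tendsto_slope_zero_right
      refine h2.congr fun t => ?_
      simp
    · filter_upwards [self_mem_nhdsWithin] with t ht
      exact ((hexp t ht).difference x y hx hy).smul (inv_nonneg.2 (le_of_lt ht))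
  refine Matrix.PosSemidef.of_tendsto (l := 𝓝[>] (0 : ℝ)) (A := fun h : ℝ => (h ^ 2)⁻¹ •
    Matrix.of fun p q : Fin n × Fin m =>
      M (u p.1 + (h : ℂ) • Pi.single p.2 1, star (u q.1) + (h : ℂ) • Pi.single q.2 1)
        - M (u p.1 + (h : ℂ) • Pi.single p.2 1, star (u q.1))
        - M (u p.1, star (u q.1) + (h : ℂ) • Pi.single q.2 1) + M (u p.1, star (u q.1)))
    (fun p q => ?_) ?_
  · refine (tendsto_secondDifference hM (isOpen_conjDouble ho)
      (z := u p.1) (v := star (u q.1)) ⟨hu _, by simpa using hu _⟩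
      (Pi.single p.2 1) (Pi.single q.2 1)).congr fun h => ?_
    simp
    ring
  · have hmem : ∀ᶠ h : ℝ in 𝓝[>] 0, ∀ p : Fin n × Fin m,
        u p.1 + (h : ℂ) • Pi.single p.2 1 ∈ Ω := by
      refine eventually_all.2 fun p => nhdsWithin_le_nhds ?_
      have hl : Continuous fun h : ℝ => u p.1 + (h : ℂ) • (Pi.single p.2 1 : Fin m → ℂ) := by
        fun_prop
      exact (hl.tendsto' 0 (u p.1) (by simp)).eventually (ho.mem_nhds (hu _))
    filter_upwards [hmem] with h hh
    have := (hcond (fun p => u p.1 + (h : ℂ) • Pi.single p.2 1) (fun p => u p.1) hh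
      fun p => hu _).smul (a := (h ^ 2)⁻¹) (by positivity)
    simpa only [star_add, star_smul, star_single_one, Complex.star_def, Complex.conj_ofReal]
      using this

open Filter Topology in
/-- If the mixed derivative of `L` is positive definite, then so is the normalization of `L` at a
point. -/
theorem isPosDefKernelOn_normalization {m : ℕ} {Ω : Set (Fin m → ℂ)} (hc : Convex ℝ Ω)
    {M : (Fin m → ℂ) × (Fin m → ℂ) → ℂ} (hM : AnalyticOnNhd ℂ M (conjDouble Ω))
    (hP : IsPosDefMatrixKernelOn Ω fun z w => Matrix.of fun i j =>
      mixedDeriv M (Pi.single i 1) (Pi.single j 1) (z, star w))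
    {w₀ : Fin m → ℂ} (hw₀ : w₀ ∈ Ω) :
    IsPosDefKernelOn Ω fun z w =>
      M (z, star w) - M (z, star w₀) - M (w₀, star w) + M (w₀, star w₀) := by
  classical
  intro n u hu
  set γ : Fin n → ℝ → Fin m → ℂ := fun a s => w₀ + (s : ℂ) • (u a - w₀) with hγ
  have hγmem : ∀ a, ∀ s ∈ Set.Icc (0 : ℝ) 1, γ a s ∈ Ω := by
    intro a s hs
    have := hc.add_smul_sub_mem hw₀ (hu a) hs
    rwa [← Complex.coe_smul] at this
  have hγstar : ∀ a s, star (γ a s) = star w₀ + (s : ℂ) • star (u a - w₀) := by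
    intro a s
    simp [hγ]
  refine Matrix.PosSemidef.of_tendsto (l := atTop) (A := fun N : ℕ => Matrix.of fun a b : Fin n =>
    ∑ k : Fin N, ∑ l : Fin N, ((N : ℂ)⁻¹ * (N : ℂ)⁻¹) *
        mixedDeriv M (u a - w₀) (star (u b - w₀))
          (w₀ + ((k / N : ℝ) : ℂ) • (u a - w₀), star w₀ + ((l / N : ℝ) : ℂ) • star (u b - w₀)))
    (fun a b => ?_) (Eventually.of_forall fun N => ?_)
  · have := tendsto_riemannSum_mixedDeriv hM (z := w₀) (x := u a - w₀) (v := star w₀)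
      (y := star (u b - w₀)) fun s hs t ht => by
        refine ⟨hγmem a s hs, ?_⟩
        rw [← hγstar, star_star]
        exact hγmem b t ht
    convert! this using 1
    simp
  · have hk : ∀ k : Fin N, (k / N : ℝ) ∈ Set.Icc (0 : ℝ) 1 := fun k =>
      ⟨by positivity, div_le_one_of_le₀ (by exact_mod_cast k.2.le) (by positivity)⟩
    -- The Riemann sum is a congruence of the block matrix at all sample points `γ a (k / N)`: row
    -- `a` has weights `N⁻¹ * (u a - w₀) i` on its own segment and zero elsewhere.
    have h := (hP.posSemidef (fun r : Fin n × Fin N => γ r.1 (r.2 / N : ℝ))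
      fun r => hγmem _ _ (hk _)).congruence (fun (a : Fin n) (r : (Fin n × Fin N) × Fin m) =>
        if a = r.1.1 then (N : ℂ)⁻¹ * (u a - w₀) r.2 else 0)
    convert! h using 1
    ext a b
    simp only [Matrix.of_apply, Fintype.sum_prod_type]
    rw [Finset.sum_eq_single a (fun a' _ ha => by simp [ha.symm]) (by simp)]
    refine Finset.sum_congr rfl fun k _ => ?_
    trans ∑ i, ∑ l : Fin N, ∑ j, (N : ℂ)⁻¹ * (u a - w₀) i * mixedDeriv M (Pi.single i 1)
      (Pi.single j 1) (γ a (k / N : ℝ), star (γ b (l / N : ℝ))) * star ((N : ℂ)⁻¹ * (u b - w₀) j)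
    · rw [Finset.sum_comm]
      refine Finset.sum_congr rfl fun l _ => ?_
      rw [hγstar, mixedDeriv_eq_sum hM, Finset.mul_sum]
      · refine Finset.sum_congr rfl fun i _ => ?_
        rw [Finset.mul_sum]
        refine Finset.sum_congr rfl fun j _ => ?_
        simp only [hγ]
        generalize mixedDeriv M _ _ _ = D
        simp
        ring
      · refine ⟨hγmem a _ (hk k), ?_⟩
        rw [← hγstar, star_star]
        exact hγmem b _ (hk l)
    · refine Finset.sum_congr rfl fun i _ => ?_
      rw [Finset.sum_eq_single b (fun b' _ hb => by simp [hb.symm]) (by simp)]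
      simp

/-- The holomorphic extension of a function that is real on the diagonal is Hermitian. -/
theorem star_eq_swap_of_diagonal {m : ℕ} {Ω : Set (Fin m → ℂ)} (ho : IsOpen Ω) (hc : Convex ℝ Ω)
    {M : (Fin m → ℂ) × (Fin m → ℂ) → ℂ} (hM : DifferentiableOn ℂ M (conjDouble Ω))
    (hreal : ∀ w ∈ Ω, star (M (w, star w)) = M (w, star w)) {z w : Fin m → ℂ}
    (hz : z ∈ Ω) (hw : w ∈ Ω) : star (M (z, star w)) = M (w, star z) := by
  -- Conjugating both the argument and the value preserves holomorphy, so the identity theorem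
  -- applies to `F`.
  set F : (Fin m → ℂ) × (Fin m → ℂ) → ℂ := fun p => M p - star (M (star p).swap) with hF
  have hd : DifferentiableOn ℂ F (conjDouble Ω) := by
    intro p hp
    have hp' : (star p).swap ∈ conjDouble Ω := ⟨hp.2, by simpa using hp.1⟩
    have h1 := (hM _ hp').differentiableAt ((isOpen_conjDouble ho).mem_nhds hp')
    have h2 : DifferentiableAt ℂ (fun q : (Fin m → ℂ) × (Fin m → ℂ) => M q.swap) (star p) :=
      DifferentiableAt.comp (f := Prod.swap) (star p) h1 (by unfold Prod.swap; fun_prop)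
    have h3 := h2.star_star
    rw [star_star] at h3
    exact (((hM _ hp).differentiableAt ((isOpen_conjDouble ho).mem_nhds hp)).sub
      h3).differentiableWithinAt
  have h := eqOn_zero_of_diagonal ho hc hd (fun u hu => by
    simp only [hF]
    rw [show (star (u, star u)).swap = (u, star u) by simp [Prod.swap, Prod.star_def], hreal u hu,
      sub_self]) (x := (w, star z)) ⟨hw, by simpa using hz⟩
  rw [hF] at h
  have h' := (sub_eq_zero.1 h).symm
  rwa [show (star (w, star z)).swap = (z, star w) by simp [Prod.swap, Prod.star_def]] at h'

/-! ### The two halves of the theorem, on small balls. -/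

theorem isComplexDomain_ball {m : ℕ} (w : Fin m → ℂ) {r : ℝ} (hr : 0 < r) :
    IsComplexDomain (Metric.ball w r) :=
  ⟨Metric.isOpen_ball, ⟨⟨w, Metric.mem_ball_self hr⟩, (convex_ball w r).isPreconnected⟩⟩

theorem IsInfinitelyDivisibleKernelOn.exists_isPosDefFunctionOn_curvatureMatrix {m : ℕ}
    {Ω : Set (Fin m → ℂ)} (hΩ : IsComplexDomain Ω) {K : (Fin m → ℂ) → (Fin m → ℂ) → ℂ}
    (hK : IsInfinitelyDivisibleKernelOn Ω K) :
    ∃ Ω₀ : Set (Fin m → ℂ), Ω₀ ⊆ Ω ∧ IsComplexDomain Ω₀ ∧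
      IsPosDefFunctionOn Ω₀ (curvatureMatrix fun w => (K w w).re) := by
  obtain ⟨w₀, hw₀⟩ := hΩ.2.1
  set κ : (Fin m → ℂ) × (Fin m → ℂ) → ℂ := fun p => K p.1 (star p.2) with hκ
  have hκa : AnalyticOnNhd ℂ κ (conjDouble Ω) := hK.sesquiholomorphic
  have hmem₀ : (w₀, star w₀) ∈ conjDouble Ω := ⟨hw₀, by simpa using hw₀⟩
  have hreal : ∀ w ∈ Ω, K w w = ((K w w).re : ℂ) := by
    intro w hw
    have h := (hK.posDef 1 (fun _ => w) fun _ => hw).diag_nonneg (i := 0)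
    exact Complex.ext (by simp) (by simpa using (Complex.nonneg_iff.1 h).2.symm)
  -- Positive real part keeps the kernel in the slit plane, where the principal logarithm is
  -- holomorphic.
  have hnear : ∀ᶠ p in nhds (w₀, star w₀), p ∈ conjDouble Ω ∧ 0 < (κ p).re := by
    refine Filter.Eventually.and ((isOpen_conjDouble hΩ.1).mem_nhds hmem₀) ?_
    have hc : ContinuousAt (fun p => (κ p).re) (w₀, star w₀) :=
      Complex.continuous_re.continuousAt.comp (hκa _ hmem₀).continuousAt
    exact hc.eventually (lt_mem_nhds (by simpa [hκ] using hK.diag_pos w₀ hw₀))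
  obtain ⟨r, hr, hball⟩ := Metric.eventually_nhds_iff_ball.1 hnear
  have hin : ∀ p ∈ conjDouble (Metric.ball w₀ r), p ∈ conjDouble Ω ∧ 0 < (κ p).re := by
    intro p hp
    refine hball p ?_
    have h1 := mem_ball_iff_norm.1 hp.1
    have h2 := mem_ball_iff_norm.1 hp.2
    rw [← norm_star, star_sub, star_star] at h2
    rw [mem_ball_iff_norm, Prod.norm_def, max_lt_iff]
    exact ⟨h1, h2⟩
  have hdiag : ∀ w ∈ Metric.ball w₀ r, (w, star w) ∈ conjDouble (Metric.ball w₀ r) :=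
    fun w hw => ⟨hw, by simpa using hw⟩
  have hsub : Metric.ball w₀ r ⊆ Ω := fun w hw => (hin _ (hdiag w hw)).1.1
  set M : (Fin m → ℂ) × (Fin m → ℂ) → ℂ := fun p => Complex.log (κ p) with hMdef
  have hM : AnalyticOnNhd ℂ M (conjDouble (Metric.ball w₀ r)) := fun p hp =>
    (hκa p (hin p hp).1).clog (Or.inl (hin p hp).2)
  have hMlog : ∀ w ∈ Metric.ball w₀ r, M (w, star w) = (Real.log (K w w).re : ℝ) := by
    intro w hw
    simp only [hMdef, hκ, star_star]
    rw [hreal w (hsub hw), Complex.ofReal_re,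
      Complex.ofReal_log (hK.diag_pos w (hsub hw)).le]
  refine ⟨Metric.ball w₀ r, hsub, isComplexDomain_ball w₀ hr,
    fun z w => Matrix.of fun i j => mixedDeriv M (Pi.single i 1) (Pi.single j 1) (z, star w),
    fun i j => ?_, fun w hw => ?_, ?_⟩
  · simp only [IsSesquiholomorphicOn, Matrix.of_apply, star_star]
    exact hM.mixedDeriv _ _
  · ext i j
    exact (curvatureMatrix_apply_eq_mixedDeriv Metric.isOpen_ball hM hMlog hw i j).symm
  · refine isPosDefMatrixKernelOn_mixedDeriv Metric.isOpen_ball hM fun t ht => ?_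
    obtain ⟨P, ⟨hPa, hPd⟩, hP⟩ := hK.pow_posDef t ht
    -- The power `P` is only prescribed on the diagonal; the identity theorem forces it to be `exp
    -- (t M)`.
    have heq : ∀ z ∈ Metric.ball w₀ r, ∀ w ∈ Metric.ball w₀ r,
        P z w = Complex.exp (t * M (z, star w)) := by
      intro z hz w hw
      have hd : DifferentiableOn ℂ (fun p : (Fin m → ℂ) × (Fin m → ℂ) =>
          P p.1 (star p.2) - Complex.exp (t * M p)) (conjDouble (Metric.ball w₀ r)) :=
        (hPa.mono hsub).differentiableOn.sub (hM.differentiableOn.const_mul _).cexp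
      have := eqOn_zero_of_diagonal Metric.isOpen_ball (convex_ball w₀ r) hd (fun u hu => by
        simp only [star_star]
        rw [hPd u (hsub hu), hMlog u hu, Real.rpow_def_of_pos (hK.diag_pos u (hsub hu))]
        push_cast
        rw [mul_comm, sub_self]) (x := (z, star w)) ⟨hz, by simpa using hw⟩
      simpa [sub_eq_zero] using this
    intro n u hu
    convert! (hP.mono hsub) n u hu using 1
    ext a b
    exact (heq _ (hu a) _ (hu b)).symm

theorem exists_isInfinitelyDivisibleKernelOn_of_curvatureMatrix {m : ℕ}
    {Ω : Set (Fin m → ℂ)} (hΩ : IsComplexDomain Ω) {F : (Fin m → ℂ) → ℝ}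
    (hF : AnalyticOnNhd ℝ F Ω) (hpos : ∀ w ∈ Ω, 0 < F w)
    (hcurv : IsPosDefFunctionOn Ω (curvatureMatrix F)) {w₀ : Fin m → ℂ} (hw₀ : w₀ ∈ Ω) :
    ∃ Ω₀ : Set (Fin m → ℂ), Ω₀ ⊆ Ω ∧ IsComplexDomain Ω₀ ∧ w₀ ∈ Ω₀ ∧
      ∃ K : (Fin m → ℂ) → (Fin m → ℂ) → ℂ,
        IsInfinitelyDivisibleKernelOn Ω₀ K ∧ ∀ w ∈ Ω₀, K w w = (F w : ℂ) := by
  obtain ⟨P, hPa, hPd, hP⟩ := hcurv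
  have hlog : AnalyticAt ℝ (fun w => ((Real.log (F w) : ℝ) : ℂ)) w₀ :=
    (Complex.ofRealCLM.analyticAt _).comp ((analyticAt_log (hpos w₀ hw₀)).comp (hF w₀ hw₀))
  obtain ⟨r₁, hr₁, M, hM₁, hMlog₁⟩ := hlog.exists_polarization
  obtain ⟨r₂, hr₂, hball⟩ := Metric.isOpen_iff.1 hΩ.1 w₀ hw₀
  set B := Metric.ball w₀ (min r₁ r₂) with hB
  have hB₁ : B ⊆ Metric.ball w₀ r₁ := Metric.ball_subset_ball (min_le_left _ _)
  have hsub : B ⊆ Ω := (Metric.ball_subset_ball (min_le_right _ _)).trans hball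
  have hBo : IsOpen B := Metric.isOpen_ball
  have hBc : Convex ℝ B := convex_ball _ _
  have hw₀B : w₀ ∈ B := Metric.mem_ball_self (lt_min hr₁ hr₂)
  have hM : AnalyticOnNhd ℂ M (conjDouble B) := hM₁.mono (conjDouble_mono hB₁)
  have hMlog : ∀ w ∈ B, M (w, star w) = (Real.log (F w) : ℝ) := fun w hw => hMlog₁ w (hB₁ hw)
  have hPeq : ∀ z ∈ B, ∀ w ∈ B, ∀ i j,
      P z w i j = mixedDeriv M (Pi.single i 1) (Pi.single j 1) (z, star w) := by
    intro z hz w hw i j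
    have hd : DifferentiableOn ℂ (fun p : (Fin m → ℂ) × (Fin m → ℂ) =>
        P p.1 (star p.2) i j - mixedDeriv M (Pi.single i 1) (Pi.single j 1) p) (conjDouble B) :=
      ((hPa i j).mono hsub).differentiableOn.sub (hM.mixedDeriv _ _).differentiableOn
    have := eqOn_zero_of_diagonal hBo hBc hd (fun u hu => by
      simp only [star_star]
      rw [hPd u (hsub hu), curvatureMatrix_apply_eq_mixedDeriv hBo hM hMlog hu, sub_self])
      (x := (z, star w)) ⟨hz, by simpa using hw⟩
    simpa [sub_eq_zero] using this
  have hmixed : IsPosDefMatrixKernelOn B fun z w => Matrix.of fun i j =>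
      mixedDeriv M (Pi.single i 1) (Pi.single j 1) (z, star w) := by
    intro n u hu
    convert! (hP.mono hsub) n u hu using 1
    ext a b
    exact (hPeq _ (hu _) _ (hu _) _ _).symm
  have hnorm := isPosDefKernelOn_normalization hBc hM hmixed hw₀B
  have hherm : ∀ z ∈ B, ∀ w ∈ B, star (M (z, star w)) = M (w, star z) := fun z hz w hw =>
    star_eq_swap_of_diagonal hBo hBc hM.differentiableOn
      (fun u hu => by rw [hMlog u hu]; exact Complex.conj_ofReal _) hz hw
  have hexp : ∀ t : ℝ, 0 < t → IsPosDefKernelOn B fun z w => Complex.exp (t * M (z, star w)) := by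
    intro t ht n u hu
    -- `M(z, w̄)` is its normalization plus `M(z, w̄₀) - M(w₀, w̄₀) / 2` plus the conjugate of that
    -- expression at `w`. Splitting the constant evenly makes the outer factor `g(z) conj g(w)`;
    -- `hherm` supplies the conjugation.
    convert! ((hnorm n u hu).smul ht.le).map_cexp.mul_star
      (fun a => Complex.exp (t * (M (u a, star w₀) - M (w₀, star w₀) / 2))) using 1
    ext a b
    have h1 : star (Complex.exp (t * (M (u b, star w₀) - M (w₀, star w₀) / 2)))
        = Complex.exp (t * (M (w₀, star (u b)) - M (w₀, star w₀) / 2)) := by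
      rw [Complex.star_def, ← Complex.exp_conj, map_mul, map_sub, map_div₀, Complex.conj_ofReal,
        ← Complex.star_def, hherm _ (hu b) _ hw₀B, hherm _ hw₀B _ hw₀B]
      simp
    simp only [Matrix.of_apply, Matrix.smul_apply, h1, ← Complex.exp_add, Complex.real_smul]
    congr 1
    ring
  have hsesq : ∀ t : ℝ, IsSesquiholomorphicOn B fun z w => Complex.exp (t * M (z, star w)) := by
    intro t
    simp only [IsSesquiholomorphicOn, star_star]
    exact fun p hp => (analyticAt_const.mul (hM p hp)).cexp'
  have hdiag : ∀ w ∈ B, Complex.exp (M (w, star w)) = (F w : ℂ) := by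
    intro w hw
    rw [hMlog w hw, ← Complex.ofReal_exp, Real.exp_log (hpos w (hsub hw))]
  refine ⟨B, hsub, isComplexDomain_ball w₀ (lt_min hr₁ hr₂), hw₀B,
    fun z w => Complex.exp (M (z, star w)), ⟨?_, ?_, fun w hw => ?_, fun t ht =>
      ⟨fun z w => Complex.exp (t * M (z, star w)), ⟨hsesq t, fun w hw => ?_⟩, hexp t ht⟩⟩, hdiag⟩
  · simpa using hsesq 1
  · simpa using hexp 1 one_pos
  · rw [hdiag w hw]
    exact hpos w (hsub hw)
  · beta_reduce
    rw [hdiag w hw, Complex.ofReal_re, hMlog w hw, Real.rpow_def_of_pos (hpos w (hsub hw))]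
    push_cast
    rw [mul_comm]

theorem mainTheorem1 (m : ℕ) (Ω : Set (Fin m → ℂ)) (hΩ : IsComplexDomain Ω) :
    (∀ K : (Fin m → ℂ) → (Fin m → ℂ) → ℂ, IsInfinitelyDivisibleKernelOn Ω K →
      ∃ Ω₀ : Set (Fin m → ℂ), Ω₀ ⊆ Ω ∧ IsComplexDomain Ω₀ ∧
        IsPosDefFunctionOn Ω₀ (curvatureMatrix fun w => (K w w).re)) ∧
    (∀ Khat : (Fin m → ℂ) → ℝ, AnalyticOnNhd ℝ Khat Ω → (∀ w ∈ Ω, 0 < Khat w) →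
      IsPosDefFunctionOn Ω (curvatureMatrix Khat) →
      ∀ w₀ ∈ Ω, ∃ Ω₀ : Set (Fin m → ℂ), Ω₀ ⊆ Ω ∧ IsComplexDomain Ω₀ ∧ w₀ ∈ Ω₀ ∧
        ∃ K : (Fin m → ℂ) → (Fin m → ℂ) → ℂ,
          IsInfinitelyDivisibleKernelOn Ω₀ K ∧ ∀ w ∈ Ω₀, K w w = (Khat w : ℂ)) :=
  ⟨fun _ hK => hK.exists_isPosDefFunctionOn_curvatureMatrix hΩ,
    fun _ hF hpos hcurv _ hw₀ =>
      exists_isInfinitelyDivisibleKernelOn_of_curvatureMatrix hΩ hF hpos hcurv hw₀⟩
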